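/- Let $m\ge 0$, $R_m=\mathbb C[t]/(t^{m+1})$, and let $\mathfrak{gl}_{\infty|\infty}[m]$ be the Lie superalgebra (under the supercommutator) of matrices $(a_{ij})_{i,j\in\frac12\mathbb Z}$ with $a_{ij}\in R_m$ and $a_{ij}=0$ for $|i-j|\gg0$, where $E_{ij}$ is even if $i-j\in\mathbb Z$ and odd otherwise. Let $\mathfrak g=\widehat{\mathfrak{gl}}_{\infty|\infty}[m]=\mathfrak{gl}_{\infty|\infty}[m]\oplus R_m$ be its central extension by the $R_m$-valued $2$-cocycle $C(A,B)=\mathrm{Str}([J,A]B)$, where $J=\sum_{r\le 0}E_{rr}$ and $\mathrm{Str}(A)=\sum_{r\in\frac12\mathbb Z}(-1)^{2r}a_{rr}$. It is $\frac12\mathbb Z$-graded, as a complex Lie superalgebra, by letting $\mathfrak g_r$ consist of the matrices supported on the diagonal $j-i=r$, with $R_m$ in degree $0$. For $\lambda\in\mathfrak g_0^*$ put $\lambda_k^{(l)}=\lambda(t^lE_{kk})$ and $c_l=\lambda(t^l)$ for $k\in\frac12\mathbb Z$, $0\le l\le m$. Let $L(\lambda)$ be the irreducible graded highest weight $\mathfrak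 g$-module with highest weight $\lambda$, i.e. $L(\lambda)_0=\mathbb C v_\lambda$ with $v_\lambda\neq0$, $hv_\lambda=\lambda(h)v_\lambda$ for $h\in\mathfrak g_0$, $\mathfrak g_rv_\lambda=0$ for $r>0$, and $v_\lambda$ generates $L(\lambda)$ under $\bigoplus_{r<0}\mathfrak g_r$. It is called quasifinite if all its homogeneous components are finite-dimensional. For $x\in R_m$ and $k\in\frac12\mathbb Z$ put $H_k(x)=x\,(E_{k,k}+E_{k-\frac12,k-\frac12}+\delta_{k,\frac12})\in\mathfrak g_0$. Call $\lambda$ termwise if $$\lambda\Big(\sum_{k\in\frac12\mathbb Z}H_k(x_k)\Big)=\sum_{k\in\frac12\mathbb Z}\lambda(H_k(x_k))$$ for every family $(x_k)_{k\in\frac12\mathbb Z}$ in $R_m$ for which the sum on the right has only finitely many non-zero terms. **Theorem.** (i) If $\lambda$ is termwise, then $L(\lambda)$ is quasifinite if and only if, for each $l=0,\dots,m$, the relation $$\lambda_k^{(l)}+\lambda_{k-\frac12}^{(l)}+\delta_{k,\frac12}\,c_l=0$$ holds for all but finitely many $k\in\frac12\mathbb Z$. (ii) For an arbitrary linear functional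 $\lambda\in\mathfrak g_0^*$, if $L(\lambda)$ is quasifinite, then $\lambda$ is termwise and the relation in (i) holds, for each $l=0,\dots,m$, for all but finitely many $k\in\frac12\mathbb Z$. -/

import Mathlib

/-! Half-integers `k ∈ ½ℤ` are encoded throughout by the integer `n = 2k`: a row, column, degree or
label index `n : ℤ` below stands for the half-integer `n / 2`.  A degree `n / 2` is odd for the
`ℤ/2`-grading exactly when the integer `n` is odd. -/

namespace GlInf

/-- The algebra `R_m = ℂ[t] / (t ^ (m + 1))` of truncated polynomials. -/
abbrev TruncPoly (m : ℕ) : Type :=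
  Polynomial ℂ ⧸ Ideal.span {(Polynomial.X : Polynomial ℂ) ^ (m + 1)}

/-- The class of `t` in `R_m`. -/
noncomputable def tVar (m : ℕ) : TruncPoly m :=
  Ideal.Quotient.mk _ Polynomial.X

/-- Matrices indexed by `½ℤ` with entries in `R_m`. -/
abbrev Mat (m : ℕ) : Type := ℤ → ℤ → TruncPoly m

/-- `gl_{∞|∞}[m]`: the matrices with only finitely many non-zero diagonals. -/
def band (m : ℕ) : Submodule ℂ (Mat m) where
  carrier := {A | ∃ N : ℤ, ∀ i j, N < |i - j| → A i j = 0}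
  zero_mem' := ⟨0, fun _ _ _ => rfl⟩
  add_mem' := by
    rintro A B ⟨N, hN⟩ ⟨K, hK⟩
    refine ⟨max N K, fun i j h => ?_⟩
    simp [hN i j (lt_of_le_of_lt (le_max_left _ _) h),
      hK i j (lt_of_le_of_lt (le_max_right _ _) h)]
  smul_mem' := by
    rintro c A ⟨N, hN⟩
    exact ⟨N, fun i j h => by simp [hN i j h]⟩

/-- The matrix product. -/
noncomputable def mul {m : ℕ} (A B : Mat m) : Mat m :=
  fun i j => ∑ᶠ k, A i k * B k j

/-- The sign `(-1) ^ (p * q)`. -/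
def sgn (p q : ℤ) : ℤ := if Odd (p * q) then -1 else 1

/-- The supercommutator of matrices, where the matrix unit `E_{ij}` has the parity of the integer
`i - j` (that is, it is odd iff the half-integers differ by an element of `ℤ + ½`). -/
noncomputable def superComm {m : ℕ} (A B : Mat m) : Mat m :=
  fun i j => ∑ᶠ k, (A i k * B k j - sgn (i - k) (k - j) • (B i k * A k j))

theorem superComm_mem {m : ℕ} {A B : Mat m} (hA : A ∈ band m) (hB : B ∈ band m) :
    superComm A B ∈ band m := by
  obtain ⟨N, hN⟩ := hA
  obtain ⟨K, hK⟩ := hB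
  refine ⟨N + K, fun i j h => ?_⟩
  have key : ∀ k, A i k * B k j - sgn (i - k) (k - j) • (B i k * A k j) = 0 := by
    intro k
    have tri : |i - j| ≤ |i - k| + |k - j| := abs_sub_le i k j
    have h1 : A i k * B k j = 0 := by
      rcases lt_or_ge N |i - k| with h' | h'
      · rw [hN i k h', zero_mul]
      · rw [hK k j (by omega), mul_zero]
    have h2 : B i k * A k j = 0 := by
      rcases lt_or_ge K |i - k| with h' | h'
      · rw [hK i k h', zero_mul]
      · rw [hN k j (by omega), mul_zero]
    rw [h1, h2, smul_zero, sub_zero]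
  simp only [superComm, key, finsum_zero]

/-- The supertrace `Str A = ∑_{r ∈ ½ℤ} (-1)^{2r} a_{rr}`. -/
noncomputable def superTrace {m : ℕ} (A : Mat m) : TruncPoly m :=
  ∑ᶠ r : ℤ, sgn r r • A r r

/-- The matrix `J = ∑_{r ≤ 0} E_{rr}`. -/
noncomputable def matJ (m : ℕ) : Mat m := fun i j => if i = j ∧ i ≤ 0 then 1 else 0

/-- The cocycle `C(A, B) = Str([J, A] B)`; for `A`, `B` with finitely many non-zero diagonals all
sums occurring in it are finite. -/
noncomputable def cocycle {m : ℕ} (A B : Mat m) : TruncPoly m :=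
  superTrace (mul (superComm (matJ m) A) B)

/-- The central extension `gl_{∞|∞}[m] ⊕ R_m`. -/
abbrev GlHat (m : ℕ) : Type := band m × TruncPoly m

/-- The superbracket of the central extension. -/
noncomputable def bracket {m : ℕ} (x y : GlHat m) : GlHat m :=
  (⟨superComm (x.1 : Mat m) (y.1 : Mat m), superComm_mem x.1.2 y.1.2⟩,
    cocycle (x.1 : Mat m) (y.1 : Mat m))

/-- The homogeneous component of degree `r` of the principal gradation: matrices supported on the
diagonal `j - i = r`, together with the centre `R_m` in degree `0`. -/
def deg (m : ℕ) (r : ℤ) : Submodule ℂ (GlHat m) where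
  carrier := {x | (∀ i j, j - i ≠ r → (x.1 : Mat m) i j = 0) ∧ (r ≠ 0 → x.2 = 0)}
  zero_mem' := ⟨fun _ _ _ => rfl, fun _ => rfl⟩
  add_mem' := by
    rintro x y ⟨h1, h2⟩ ⟨h3, h4⟩
    exact ⟨fun i j h => by simp [h1 i j h, h3 i j h], fun h => by simp [h2 h, h4 h]⟩
  smul_mem' := by
    rintro c x ⟨h1, h2⟩
    exact ⟨fun i j h => by simp [h1 i j h], fun h => by simp [h2 h]⟩

/-- A `½ℤ`-graded module over the central extension of `gl_{∞|∞}[m]`, on the vector space `V`. Since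
every element of the superalgebra is a finite sum of homogeneous ones, it is enough to impose the
module axiom on homogeneous elements. -/
structure GradedModule (m : ℕ) (V : Type*) [AddCommGroup V] [Module ℂ V] where
  /-- the action -/
  act : GlHat m →ₗ[ℂ] Module.End ℂ V
  act_bracket : ∀ (i j : ℤ) (x y : GlHat m), x ∈ deg m i → y ∈ deg m j →
    act (bracket x y) = act x * act y - sgn i j • (act y * act x)
  /-- the homogeneous components of `V` -/
  gr : ℤ → Submodule ℂ V
  isInternal : DirectSum.IsInternal gr
  act_gr : ∀ (i j : ℤ) (x : GlHat m) (w : V), x ∈ deg m i → w ∈ gr j → act x w ∈ gr (i + j)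

namespace GradedModule

variable {m : ℕ} {V : Type*} [AddCommGroup V] [Module ℂ V]

/-- A graded module is quasifinite if all its homogeneous components are finite-dimensional. -/
def IsQuasifinite (M : GradedModule m V) : Prop :=
  ∀ j : ℤ, FiniteDimensional ℂ (M.gr j)

/-- `M` is a highest weight module with highest weight `Λ ∈ (g_0)^*` and highest weight vector
`v`. The last field says `U(g_-) v = V`. -/
structure IsHighestWeight (M : GradedModule m V) (Λ : Module.Dual ℂ (deg m 0)) (v : V) :
    Prop where
  ne_zero : v ≠ 0
  gr_zero : M.gr 0 = Submodule.span ℂ {v}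
  act_zero : ∀ h : deg m 0, M.act (h : GlHat m) v = Λ h • v
  act_pos : ∀ r : ℤ, 0 < r → ∀ x ∈ deg m r, M.act x v = 0
  generated : ∀ W : Submodule ℂ V, v ∈ W →
    (∀ r : ℤ, r < 0 → ∀ x ∈ deg m r, ∀ w ∈ W, M.act x w ∈ W) → W = ⊤

/-- `M` is irreducible: it is non-zero and has no proper non-zero graded submodule. -/
def IsIrreducible (M : GradedModule m V) : Prop :=
  Nontrivial V ∧ ∀ W : Submodule ℂ V, (∀ x : GlHat m, ∀ w ∈ W, M.act x w ∈ W) →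
    (W = ⨆ j : ℤ, W ⊓ M.gr j) → W = ⊥ ∨ W = ⊤

end GradedModule

/-- The element `∑_k d_k E_{kk} + c` of degree `0`. -/
noncomputable def diagEl {m : ℕ} (d : ℤ → TruncPoly m) (c : TruncPoly m) : deg m 0 :=
  ⟨(⟨fun i j => if i = j then d i else 0, 0, fun i j h =>
      if_neg (fun e => by simp [e] at h)⟩, c),
    fun i j h => if_neg (fun e => h (by omega)), fun h => absurd rfl h⟩

/-- The label `λ_k^{(l)} = λ(t^l E_{kk})`. -/
noncomputable def label {m : ℕ} (Λ : Module.Dual ℂ (deg m 0)) (l : ℕ) (k : ℤ) : ℂ :=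
  Λ (diagEl (Pi.single k (tVar m ^ l)) 0)

/-- The central charge `c_l = λ(t^l)`. -/
noncomputable def charge {m : ℕ} (Λ : Module.Dual ℂ (deg m 0)) (l : ℕ) : ℂ :=
  Λ (diagEl 0 (tVar m ^ l))

/-- The infinite sum `∑_k x_k (E_{k,k} + E_{k-½,k-½} + δ_{k,½})` in degree `0`. -/
noncomputable def pairEl {m : ℕ} (x : ℤ → TruncPoly m) : deg m 0 :=
  diagEl (fun i => x i + x (i + 1)) (x 1)

/-- `λ` is evaluated term by term on the sums `∑_k x_k (E_{k,k} + E_{k-½,k-½} + δ_{k,½})`, as soon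
as the resulting sum of complex numbers has only finitely many non-zero terms. -/
def IsTermwise {m : ℕ} (Λ : Module.Dual ℂ (deg m 0)) : Prop :=
  ∀ x : ℤ → TruncPoly m,
    (Function.support fun k : ℤ => Λ (pairEl (Pi.single k (x k)))).Finite →
      Λ (pairEl x) = ∑ᶠ k : ℤ, Λ (pairEl (Pi.single k (x k)))

/-- For each `l = 0, …, m` one has `λ_k^{(l)} + λ_{k-½}^{(l)} + δ_{k,½} c_l = 0` for all but
finitely many `k ∈ ½ℤ`. -/
def LabelCondition {m : ℕ} (Λ : Module.Dual ℂ (deg m 0)) : Prop :=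
  ∀ l : ℕ, l ≤ m → ∀ᶠ k : ℤ in Filter.cofinite,
    label Λ l k + label Λ l (k - 1) + (if k = 1 then charge Λ l else 0) = 0

end GlInf

namespace GlInf

/-! ### Homogeneous elements, their superbrackets and the cocycle. -/

variable {m : ℕ}

/-! Everything rests on one pairing: for elements of degrees ½ and -½ with coefficients `x` and `y`,
the superbracket is `∑_k x_{k-½} y_k H_k`, and on `v` it acts by the value of `λ` there.

If the component of degree -½ is finite-dimensional, some non-zero polynomial `p` in the index makes
`∑_k p(k) E_{k,k-½}` kill `v`. Since `p` has finitely many roots, dividing by it shows that `λ`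
vanishes on every `∑_k x_k H_k` supported off these roots (`exists_finset_of_finiteDimensional`).
Termwise evaluation and the relation on labels both follow.

Conversely, termwise evaluation turns the relation into this same vanishing far from the origin.
Elements of degree -½ supported far away then send `v` to singular vectors, which are zero by
irreducibility (`killedFar_one`). Brackets extend this to all negative degrees (`KilledFar.succ`)
and to all vectors (`killedFar`). Hence a negative component acts on each vector through finitely
many coefficients, and induction on the degree bounds every component. -/

/-- The element `∑_i x_i E_{i,i+r}` of degree `r`. -/
noncomputable def shiftEl (m : ℕ) (r : ℤ) : (ℤ → TruncPoly m) →ₗ[ℂ] GlHat m where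
  toFun x := (⟨fun i j => if j = i + r then x i else 0, |r|, fun i j h =>
    if_neg fun e => by
      have : i - j = -r := by omega
      rw [this, abs_neg] at h
      exact lt_irrefl _ h⟩, 0)
  map_add' x y := by
    refine Prod.ext (Subtype.ext (funext fun i => funext fun j => ?_)) (by simp)
    by_cases h : j = i + r <;> simp [h]
  map_smul' c x := by
    refine Prod.ext (Subtype.ext (funext fun i => funext fun j => ?_)) (by simp)
    by_cases h : j = i + r <;> simp [h]

theorem shiftEl_apply (r : ℤ) (x : ℤ → TruncPoly m) (i j : ℤ) :
    ((shiftEl m r x).1 : Mat m) i j = if j = i + r then x i else 0 := rfl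

theorem shiftEl_snd (r : ℤ) (x : ℤ → TruncPoly m) : (shiftEl m r x).2 = 0 := rfl

theorem shiftEl_mem (r : ℤ) (x : ℤ → TruncPoly m) : shiftEl m r x ∈ deg m r :=
  ⟨fun i j h => by rw [shiftEl_apply, if_neg (by omega)], fun _ => rfl⟩

theorem exists_shiftEl {r : ℤ} (hr : r ≠ 0) {a : GlHat m} (ha : a ∈ deg m r) :
    ∃ x, a = shiftEl m r x := by
  refine ⟨fun i => (a.1 : Mat m) i (i + r),
    Prod.ext (Subtype.ext (funext fun i => funext fun j => ?_)) (ha.2 hr)⟩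
  rw [shiftEl_apply]
  split_ifs with h
  · rw [h]
  · exact ha.1 i j (by omega)

theorem iSup_deg_eq_top (m : ℕ) : ⨆ r, deg m r = ⊤ := by
  rw [eq_top_iff]
  rintro ⟨A, c⟩ -
  obtain ⟨N, hN⟩ := A.2
  have h0 : ((0, c) : GlHat m) ∈ ⨆ r, deg m r :=
    Submodule.mem_iSup_of_mem 0 ⟨fun _ _ _ => rfl, fun h => absurd rfl h⟩
  have h1 : (∑ r ∈ Finset.Icc (-N) N, shiftEl m r fun i => (A : Mat m) i (i + r)) ∈ ⨆ r, deg m r :=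
    Submodule.sum_mem _ fun r _ => Submodule.mem_iSup_of_mem r (shiftEl_mem _ _)
  suffices e : ((A, c) : GlHat m) =
      (∑ r ∈ Finset.Icc (-N) N, shiftEl m r fun i => (A : Mat m) i (i + r)) + (0, c) from
    e ▸ add_mem h1 h0
  refine Prod.ext (Subtype.ext (funext fun i => funext fun j => ?_)) ?_
  · simp only [Prod.fst_add, Prod.fst_sum, add_zero, Submodule.coe_sum, Finset.sum_apply,
      shiftEl_apply]
    by_cases h : j - i ∈ Finset.Icc (-N) N
    · rw [Finset.sum_eq_single_of_mem _ h]
      · rw [if_pos (by ring), show i + (j - i) = j by ring]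
      · exact fun b _ hb => if_neg (by omega)
    · rw [Finset.sum_eq_zero]
      · refine hN i j ?_
        rw [Finset.mem_Icc] at h
        rw [lt_abs]
        omega
      · intro b hb
        refine if_neg fun e => h ?_
        rw [Finset.mem_Icc] at hb ⊢
        omega
  · simp [Prod.snd_sum, shiftEl_snd]

theorem sgn_zero_left (q : ℤ) : sgn 0 q = 1 := by simp [sgn]

theorem sgn_zero_right (q : ℤ) : sgn q 0 = 1 := by simp [sgn]

/-- As `J` is diagonal, hence even, only entries that straddle its cutoff survive. -/
theorem superComm_matJ (A : Mat m) (i j : ℤ) :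
    superComm (matJ m) A i j = (matJ m i i - matJ m j j) * A i j := by
  have hJ : ∀ a b : ℤ, a ≠ b → matJ m a b = 0 := fun a b h => if_neg fun e => h e.1
  rw [superComm]
  by_cases h : i = j
  · subst h
    rw [finsum_eq_single _ i]
    · simp [sgn_zero_left, mul_comm]
    · intro k hk
      simp [hJ _ _ hk, hJ _ _ hk.symm]
  · have e : (Function.support fun k => matJ m i k * A k j -
        sgn (i - k) (k - j) • (A i k * matJ m k j)) ⊆ (({i, j} : Finset ℤ) : Set ℤ) := by
      intro k hk
      by_contra hk'
      simp only [Finset.coe_insert, Finset.coe_singleton, Set.mem_insert_iff,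
        Set.mem_singleton_iff, not_or] at hk'
      exact hk (by simp [hJ _ _ (Ne.symm hk'.1), hJ _ _ hk'.2])
    rw [finsum_eq_sum_of_support_subset _ e, Finset.sum_pair h]
    simp [hJ _ _ h, sgn_zero_left, sgn_zero_right]
    ring

theorem cocycle_eq (A B : Mat m) :
    cocycle A B = ∑ᶠ r : ℤ, sgn r r • ∑ᶠ k, (matJ m r r - matJ m k k) * A r k * B k r := by
  simp only [cocycle, superTrace, mul, superComm_matJ]

theorem bracket_mem_deg {r s : ℤ} {a b : GlHat m} (ha : a ∈ deg m r) (hb : b ∈ deg m s) :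
    bracket a b ∈ deg m (r + s) := by
  refine ⟨fun i j h => ?_, fun h => ?_⟩
  · change superComm _ _ i j = 0
    rw [superComm]
    refine (finsum_congr fun k => ?_).trans finsum_zero
    have h1 : (a.1 : Mat m) i k * (b.1 : Mat m) k j = 0 := by
      by_cases hk : k - i = r
      · rw [hb.1 k j (by omega), mul_zero]
      · rw [ha.1 i k hk, zero_mul]
    have h2 : (b.1 : Mat m) i k * (a.1 : Mat m) k j = 0 := by
      by_cases hk : k - i = s
      · rw [ha.1 k j (by omega), mul_zero]
      · rw [hb.1 i k hk, zero_mul]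
    rw [h1, h2, smul_zero, sub_zero]
  · change cocycle _ _ = 0
    rw [cocycle_eq]
    refine (finsum_congr fun i => ?_).trans finsum_zero
    rw [(finsum_congr fun k => ?_).trans finsum_zero, smul_zero]
    by_cases hk : k - i = r
    · rw [hb.1 k i (by omega), mul_zero]
    · rw [ha.1 i k hk, mul_zero, zero_mul]

theorem superComm_shiftEl (r s : ℤ) (x y : ℤ → TruncPoly m) (i j : ℤ) :
    superComm ((shiftEl m r x).1 : Mat m) ((shiftEl m s y).1 : Mat m) i j =
      if j = i + (r + s) then x i * y (i + r) - sgn r s • (y i * x (i + s)) else 0 := by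
  split_ifs with h
  · have e1 : ∀ k, ((shiftEl m r x).1 : Mat m) i k * ((shiftEl m s y).1 : Mat m) k j =
        if k = i + r then x i * y (i + r) else 0 := by
      intro k
      rw [shiftEl_apply, shiftEl_apply]
      split_ifs with h1 h2 <;> first | rfl | (subst h1; first | rfl | omega) | simp
    have e2 : ∀ k, sgn (i - k) (k - j) • (((shiftEl m s y).1 : Mat m) i k *
        ((shiftEl m r x).1 : Mat m) k j) =
        if k = i + s then sgn r s • (y i * x (i + s)) else 0 := by
      intro k
      rw [shiftEl_apply, shiftEl_apply]
      by_cases h1 : k = i + s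
      · rw [if_pos h1, if_pos (by omega), if_pos h1]
        have : sgn (i - k) (k - j) = sgn r s := by
          rw [show i - k = -s by omega, show k - j = -r by omega, sgn, sgn, neg_mul_neg, mul_comm]
        rw [this, h1]
      · rw [if_neg h1, if_neg h1, zero_mul, smul_zero]
    rw [superComm]
    simp only [e1, e2]
    rw [finsum_sub_distrib, finsum_eq_single _ (i + r), finsum_eq_single _ (i + s),
      if_pos rfl, if_pos rfl]
    · exact fun k hk => if_neg hk
    · exact fun k hk => if_neg hk
    · exact (Set.finite_singleton (i + r)).subset fun k hk => by
        by_contra h'; exact hk (if_neg h')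
    · exact (Set.finite_singleton (i + s)).subset fun k hk => by
        by_contra h'; exact hk (if_neg h')
  · have hb := bracket_mem_deg (shiftEl_mem r x) (shiftEl_mem s y)
    exact hb.1 i j (by omega)

theorem bracket_shiftEl {r s : ℤ} (h : r + s ≠ 0) (x y : ℤ → TruncPoly m) :
    bracket (shiftEl m r x) (shiftEl m s y) =
      shiftEl m (r + s) fun i => x i * y (i + r) - sgn r s • (y i * x (i + s)) := by
  refine Prod.ext (Subtype.ext (funext fun i => funext fun j => ?_)) ?_
  · exact superComm_shiftEl r s x y i j
  · exact (bracket_mem_deg (shiftEl_mem r x) (shiftEl_mem s y)).2 h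

/-- Both elements are odd, so the bracket is an anticommutator; this is the origin of the plus sign
in `H_k`. -/
theorem bracket_shiftEl_one_neg_one (x y : ℤ → TruncPoly m) :
    bracket (shiftEl m 1 x) (shiftEl m (-1) y) = pairEl fun k => x (k - 1) * y k := by
  refine Prod.ext (Subtype.ext (funext fun i => funext fun j => ?_)) ?_
  · refine (superComm_shiftEl 1 (-1) x y i j).trans ?_
    change _ = if i = j then _ else 0
    by_cases h : i = j
    · subst h
      have : sgn 1 (-1) = -1 := by decide
      simp [this, add_comm, sub_eq_add_neg, mul_comm]
    · rw [if_neg h, if_neg (by omega)]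
  · change cocycle _ _ = x (1 - 1) * y 1
    -- The indices 0 and 1 are the only neighbours separated by the cutoff of `J`, so the cocycle
    -- reduces to a single term.
    rw [cocycle_eq, finsum_eq_single _ 0, finsum_eq_single _ 1]
    · simp [sgn_zero_left, shiftEl_apply, matJ]
    · intro k hk
      rw [shiftEl_apply, if_neg (by omega), mul_zero, zero_mul]
    · intro i hi
      rw [(finsum_congr fun k => ?_).trans finsum_zero, smul_zero]
      rw [shiftEl_apply]
      split_ifs with hk
      · subst hk
        have : matJ m i i = matJ m (i + 1) (i + 1) := by
          simp only [matJ, true_and]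
          congr 1
          exact propext (by omega)
        rw [this, sub_self, zero_mul, zero_mul]
      · rw [mul_zero, zero_mul]

/-! ### Values of `λ` on the elements `H_k`. -/

/-- The linear map `x ↦ ∑_k x_k (E_{k,k} + E_{k-½,k-½} + δ_{k,½})`. -/
noncomputable def pairLin (m : ℕ) : (ℤ → TruncPoly m) →ₗ[ℂ] deg m 0 where
  toFun := pairEl
  map_add' x y := by
    refine Subtype.ext (Prod.ext (Subtype.ext (funext fun i => funext fun j => ?_)) rfl)
    by_cases h : i = j <;> simp [pairEl, diagEl, h]
    ring
  map_smul' c x := by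
    refine Subtype.ext (Prod.ext (Subtype.ext (funext fun i => funext fun j => ?_)) rfl)
    by_cases h : i = j <;> simp [pairEl, diagEl, h]

theorem pairLin_apply (x : ℤ → TruncPoly m) : pairLin m x = pairEl x := rfl

theorem apply_pairEl_single (Λ : Module.Dual ℂ (deg m 0)) (l : ℕ) (k : ℤ) :
    Λ (pairEl (Pi.single k (tVar m ^ l))) =
      label Λ l k + label Λ l (k - 1) + (if k = 1 then charge Λ l else 0) := by
  have e : pairEl (Pi.single k (tVar m ^ l)) =
      diagEl (Pi.single k (tVar m ^ l)) 0 + diagEl (Pi.single (k - 1) (tVar m ^ l)) 0 +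
        (if k = 1 then diagEl 0 (tVar m ^ l) else 0) := by
    refine Subtype.ext (Prod.ext (Subtype.ext (funext fun i => funext fun j => ?_)) ?_)
    · have h1 : (Pi.single k (tVar m ^ l) : ℤ → TruncPoly m) (i + 1) =
          (Pi.single (k - 1) (tVar m ^ l) : ℤ → TruncPoly m) i := by
        simp only [Pi.single_apply]
        congr 1
        exact propext (by omega)
      have h2 : ((if k = 1 then diagEl 0 (tVar m ^ l) else 0 : deg m 0).1.1 : Mat m) i j = 0 := by
        split_ifs
        · exact ite_self 0
        · rfl
      simp only [Submodule.coe_add, Prod.fst_add, Pi.add_apply, h2, add_zero]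
      change (if i = j then _ else 0) = (if i = j then _ else 0) + if i = j then _ else 0
      split_ifs
      · rw [h1]
      · rw [add_zero]
    · by_cases hk : k = 1
      · simp [pairEl, diagEl, hk]
      · simp [pairEl, diagEl, hk, Pi.single_apply, Ne.symm hk]
  rw [e, map_add, map_add]
  split_ifs <;> simp [label, charge]

/-- If `λ(t^l H_k) = 0` for `l ≤ m`, then `λ` vanishes on all `H_k(y)`. -/
theorem apply_pairEl_single_eq_zero (Λ : Module.Dual ℂ (deg m 0)) {k : ℤ}
    (h : ∀ l ≤ m, Λ (pairEl (Pi.single k (tVar m ^ l))) = 0) (y : TruncPoly m) :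
    Λ (pairEl (Pi.single k y)) = 0 := by
  obtain ⟨p, rfl⟩ := Ideal.Quotient.mk_surjective y
  let f : Polynomial ℂ →ₗ[ℂ] ℂ := Λ ∘ₗ pairLin m ∘ₗ LinearMap.single ℂ (fun _ => TruncPoly m) k ∘ₗ
    (Ideal.Quotient.mkₐ ℂ (Ideal.span {(Polynomial.X : Polynomial ℂ) ^ (m + 1)})).toLinearMap
  suffices f = 0 from LinearMap.congr_fun this p
  refine Polynomial.lhom_ext' fun l => LinearMap.ext_ring ?_
  change Λ (pairEl (Pi.single k (Ideal.Quotient.mk _ (Polynomial.monomial l 1)))) = 0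
  rw [← Polynomial.X_pow_eq_monomial, map_pow]
  rcases le_or_gt l m with hl | hl
  · exact h l hl
  -- Powers beyond `t^m` vanish in `R_m`, so the labels with `l ≤ m` suffice.
  · rw [← map_pow, Ideal.Quotient.eq_zero_iff_mem.mpr, Pi.single_zero]
    · exact map_zero (Λ ∘ₗ pairLin m)
    · exact Ideal.mem_span_singleton.mpr (pow_dvd_pow _ hl)

/-! ### Graded modules, singular vectors, and the consequences of quasifiniteness. -/

namespace GradedModule

variable {m : ℕ} {V : Type*} [AddCommGroup V] [Module ℂ V]
  {Λ : Module.Dual ℂ (deg m 0)} {L : GradedModule m V} {v : V}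

theorem act_act (L : GradedModule m V) {i j : ℤ} {x y : GlHat m} (hx : x ∈ deg m i)
    (hy : y ∈ deg m j) (w : V) :
    L.act x (L.act y w) = L.act (bracket x y) w + sgn i j • L.act y (L.act x w) := by
  rw [L.act_bracket i j x y hx hy]
  simp

theorem mem_gr_add (L : GradedModule m V) {i j k : ℤ} {x : GlHat m} {w : V} (hx : x ∈ deg m i)
    (hw : w ∈ L.gr j) (h : i + j = k) : L.act x w ∈ L.gr k :=
  h ▸ L.act_gr i j x w hx hw

theorem eq_zero_of_mem_gr (L : GradedModule m V) {s : Set ℤ} {i : ℤ} (hi : i ∉ s) {w : V}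
    (h1 : w ∈ L.gr i) (h2 : w ∈ ⨆ j ∈ s, L.gr j) : w = 0 :=
  (Submodule.disjoint_def.mp (L.isInternal.submodule_iSupIndep.disjoint_biSup hi)) w h1 h2

theorem act_mem_biSup (L : GradedModule m V) {s t : Set ℤ} {r : ℤ} (h : ∀ i ∈ s, r + i ∈ t)
    {x : GlHat m} (hx : x ∈ deg m r) {w : V} (hw : w ∈ ⨆ j ∈ s, L.gr j) :
    L.act x w ∈ ⨆ j ∈ t, L.gr j := by
  have : (⨆ j ∈ s, L.gr j) ≤ (⨆ j ∈ t, L.gr j).comap (L.act x) :=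
    iSup₂_le fun j hj u hu =>
      Submodule.mem_iSup_of_mem (r + j) (Submodule.mem_iSup_of_mem (h j hj) (L.act_gr r j x u hx hu))
  exact this hw

theorem act_mem_of_homogeneous (L : GradedModule m V) {W : Submodule ℂ V} {w : V}
    (h : ∀ r : ℤ, ∀ x ∈ deg m r, L.act x w ∈ W) (x : GlHat m) : L.act x w ∈ W := by
  have : (⨆ r, deg m r) ≤ W.comap (L.act.flip w) := iSup_le fun r x hx => h r x hx
  rw [iSup_deg_eq_top] at this
  exact this trivial

namespace IsHighestWeight

theorem mem_gr_zero (hL : L.IsHighestWeight Λ v) : v ∈ L.gr 0 :=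
  hL.gr_zero ▸ Submodule.mem_span_singleton_self v

theorem gr_eq_bot (hL : L.IsHighestWeight Λ v) {i : ℤ} (hi : 0 < i) : L.gr i = ⊥ := by
  have h : (⨆ j ∈ Set.Iic (0 : ℤ), L.gr j) = ⊤ :=
    hL.generated _ (Submodule.mem_iSup_of_mem 0
      (Submodule.mem_iSup_of_mem (Set.mem_Iic.mpr le_rfl) hL.mem_gr_zero))
      fun r hr x hx w hw => L.act_mem_biSup (fun i (hi : i ≤ 0) => Set.mem_Iic.mpr (by omega)) hx hw
  exact eq_bot_iff.mpr fun w hw =>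
    L.eq_zero_of_mem_gr (s := Set.Iic 0) (by simpa using hi) hw (h ▸ Submodule.mem_top)

/-- A singular vector of negative degree in an irreducible highest weight module is zero. -/
theorem eq_zero_of_singular (hL : L.IsHighestWeight Λ v) (hirr : L.IsIrreducible) {n : ℤ}
    (hn : n < 0) {u : V} (hu : u ∈ L.gr n)
    (hpos : ∀ r : ℤ, 0 < r → ∀ x ∈ deg m r, L.act x u = 0) : u = 0 := by
  -- All singular vectors of degree `n` are taken together because degree 0 preserves this set, but
  -- not the line of a single `u`. The submodule `W` they generate is graded and lies in negative
  -- degrees, so it misses `v` and must be zero.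
  let K : Set V := {u | u ∈ L.gr n ∧ ∀ r : ℤ, 0 < r → ∀ x ∈ deg m r, L.act x u = 0}
  let W : Submodule ℂ V :=
    sInf {U | K ⊆ U ∧ ∀ r : ℤ, r < 0 → ∀ x ∈ deg m r, ∀ w ∈ U, L.act x w ∈ U}
  have hWK : K ⊆ W := fun u hu => Submodule.mem_sInf.mpr fun U hU => hU.1 hu
  have hWneg : ∀ r : ℤ, r < 0 → ∀ x ∈ deg m r, ∀ w ∈ W, L.act x w ∈ W := fun r hr x hx w hw =>
    Submodule.mem_sInf.mpr fun U hU => hU.2 r hr x hx w (Submodule.mem_sInf.mp hw U hU)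
  have hmin : ∀ U : Submodule ℂ V, K ⊆ U →
      (∀ r : ℤ, r < 0 → ∀ x ∈ deg m r, ∀ w ∈ U, L.act x w ∈ U) → W ≤ U :=
    fun U h1 h2 => sInf_le ⟨h1, h2⟩
  -- By minimality of `W`, it is enough that the vectors sent into `W` by all non-negative degrees
  -- contain `K` and are stable under negative degrees; the latter comes from commuting operators.
  have hWnonneg : ∀ w ∈ W, ∀ r : ℤ, 0 ≤ r → ∀ x ∈ deg m r, L.act x w ∈ W := by
    let U : Submodule ℂ V :=
      { carrier := {w | w ∈ W ∧ ∀ r : ℤ, 0 ≤ r → ∀ x ∈ deg m r, L.act x w ∈ W}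
        zero_mem' := ⟨W.zero_mem, fun r _ x _ => by rw [map_zero]; exact W.zero_mem⟩
        add_mem' := fun {a b} ha hb => ⟨W.add_mem ha.1 hb.1, fun r hr x hx => by
          rw [map_add]; exact W.add_mem (ha.2 r hr x hx) (hb.2 r hr x hx)⟩
        smul_mem' := fun c a ha => ⟨W.smul_mem c ha.1, fun r hr x hx => by
          rw [map_smul]; exact W.smul_mem c (ha.2 r hr x hx)⟩ }
    suffices W ≤ U from fun w hw => (this hw).2
    refine hmin U (fun u hu => ⟨hWK hu, fun r hr x hx => ?_⟩)
      fun r hr x hx w hw => ⟨hWneg r hr x hx w hw.1, fun s hs y hy => ?_⟩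
    · rcases hr.eq_or_lt with rfl | hr
      · refine hWK ⟨L.mem_gr_add hx hu.1 (zero_add n), fun s hs y hy => ?_⟩
        rw [L.act_act hy hx, hu.2 s hs y hy, map_zero, smul_zero, add_zero]
        exact hu.2 (s + 0) (by omega) _ (bracket_mem_deg hy hx)
      · rw [hu.2 r hr x hx]
        exact W.zero_mem
    · rw [L.act_act hy hx]
      refine W.add_mem ?_ (zsmul_mem (hWneg r hr x hx _ (hw.2 s hs y hy)) _)
      rcases lt_or_ge (s + r) 0 with h | h
      · exact hWneg _ h _ (bracket_mem_deg hy hx) w hw.1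
      · exact hw.2 _ h _ (bracket_mem_deg hy hx)
  have hgraded : W ≤ ⨆ j : ℤ, W ⊓ L.gr j := by
    refine hmin _ (fun u hu => Submodule.mem_iSup_of_mem n ⟨hWK hu, hu.1⟩) fun r hr x hx w hw => ?_
    have : (⨆ j : ℤ, W ⊓ L.gr j) ≤ (⨆ j : ℤ, W ⊓ L.gr j).comap (L.act x) :=
      iSup_le fun j u hu => Submodule.mem_iSup_of_mem (r + j)
        ⟨hWneg r hr x hx u hu.1, L.act_gr r j x u hx hu.2⟩
    exact this hw
  have hlt : W ≤ ⨆ j ∈ Set.Iio (0 : ℤ), L.gr j := by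
    refine hmin _ (fun u hu => Submodule.mem_iSup_of_mem n
      (Submodule.mem_iSup_of_mem (Set.mem_Iio.mpr hn) hu.1)) fun r hr x hx w hw => ?_
    exact L.act_mem_biSup (fun i (hi : i < 0) => Set.mem_Iio.mpr (by omega)) hx hw
  have hstable : ∀ x : GlHat m, ∀ w ∈ W, L.act x w ∈ W := fun x w hw =>
    L.act_mem_of_homogeneous (fun r x hx => (lt_or_ge r 0).elim
      (fun h => hWneg r h x hx w hw) fun h => hWnonneg w hw r h x hx) x
  have huW : u ∈ W := hWK ⟨hu, hpos⟩
  rcases hirr.2 W hstable (le_antisymm hgraded (iSup_le fun j => inf_le_left)) with h | h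
  · rwa [h, Submodule.mem_bot] at huW
  · refine absurd (L.eq_zero_of_mem_gr (s := Set.Iio 0) (by simp) hL.mem_gr_zero
      (hlt ?_)) hL.ne_zero
    rw [h]
    trivial

/-- The contravariant pairing between degrees `½` and `-½` on the highest weight vector. -/
theorem act_one_act_neg_one (hL : L.IsHighestWeight Λ v) (x y : ℤ → TruncPoly m) :
    L.act (shiftEl m 1 x) (L.act (shiftEl m (-1) y) v) =
      Λ (pairEl fun k => x (k - 1) * y k) • v := by
  rw [L.act_act (shiftEl_mem _ _) (shiftEl_mem _ _), hL.act_pos 1 one_pos _ (shiftEl_mem _ _),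
    map_zero, smul_zero, add_zero, bracket_shiftEl_one_neg_one, hL.act_zero]

/-- In a quasifinite module, `λ` vanishes on the sums `∑_k x_k H_k` supported away from some finite
set. -/
theorem exists_finset_of_finiteDimensional (hL : L.IsHighestWeight Λ v)
    (hfin : FiniteDimensional ℂ (L.gr (-1))) :
    ∃ T : Finset ℤ, ∀ x : ℤ → TruncPoly m, (∀ k ∈ T, x k = 0) → Λ (pairEl x) = 0 := by
  -- Scalar sequences `k ↦ p(k)`: an infinite-dimensional family whose non-zero members have
  -- finitely many zeros and are invertible elsewhere.
  let z : Polynomial ℂ →ₗ[ℂ] (ℤ → TruncPoly m) :=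
    LinearMap.pi fun k : ℤ => (Algebra.linearMap ℂ (TruncPoly m)) ∘ₗ Polynomial.leval (k : ℂ)
  let f : Polynomial ℂ →ₗ[ℂ] L.gr (-1) :=
    ((L.act.flip v) ∘ₗ shiftEl m (-1) ∘ₗ z).codRestrict _
      fun p => L.mem_gr_add (shiftEl_mem _ _) hL.mem_gr_zero rfl
  have hf : ¬ Function.Injective f := fun hf => by
    have := FiniteDimensional.of_injective f hf
    exact Polynomial.not_finite this
  obtain ⟨p, hp, hp0⟩ : ∃ p, f p = 0 ∧ p ≠ 0 := by
    by_contra! h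
    exact hf ((injective_iff_map_eq_zero f).mpr h)
  have hp' : L.act (shiftEl m (-1) (z p)) v = 0 := congrArg Subtype.val hp
  have hfinite : {k : ℤ | p.eval (k : ℂ) = 0}.Finite := by
    have := (p.rootSet_finite ℂ).preimage (f := fun k : ℤ => (k : ℂ)) Int.cast_injective.injOn
    refine this.subset fun k hk => ?_
    simpa [Polynomial.mem_rootSet, hp0] using hk
  refine ⟨hfinite.toFinset, fun x hx => ?_⟩
  -- The shift by one cancels the `k - 1` in the pairing, leaving exactly `x` after multiplication
  -- by `p(k)`.
  have h := hL.act_one_act_neg_one (fun k => (p.eval ((k + 1 : ℤ) : ℂ))⁻¹ • x (k + 1)) (z p)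
  rw [hp', map_zero] at h
  have e : (fun k => ((p.eval ((k - 1 + 1 : ℤ) : ℂ))⁻¹ • x (k - 1 + 1)) * z p k) = x := by
    funext k
    rw [sub_add_cancel]
    by_cases hk : p.eval (k : ℂ) = 0
    · rw [hx k (hfinite.mem_toFinset.mpr hk), smul_zero, zero_mul]
    · change _ * algebraMap ℂ (TruncPoly m) (p.eval (k : ℂ)) = _
      rw [mul_comm, ← Algebra.smul_def, smul_smul, mul_inv_cancel₀ hk, one_smul]
  rw [e] at h
  exact (smul_eq_zero.mp h.symm).resolve_right hL.ne_zero

end IsHighestWeight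

end GradedModule

theorem isTermwise_of_finset {m : ℕ} {Λ : Module.Dual ℂ (deg m 0)} {T : Finset ℤ}
    (hT : ∀ x : ℤ → TruncPoly m, (∀ k ∈ T, x k = 0) → Λ (pairEl x) = 0) : IsTermwise Λ := by
  intro x _
  have h0 : ∀ k ∉ T, Λ (pairEl (Pi.single k (x k))) = 0 := fun k hk =>
    hT _ fun i hi => Pi.single_eq_of_ne (fun e : i = k => hk (e ▸ hi)) _
  rw [finsum_eq_sum_of_support_subset (s := T) _ fun k hk => by
    by_contra h; exact hk (h0 k h)]
  -- Removing the finitely many terms in `T` leaves a family on which `λ` vanishes; finite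
  -- additivity does the rest.
  have h1 := hT (x - ∑ k ∈ T, Pi.single k (x k)) fun k hk => by
    rw [Pi.sub_apply, Finset.sum_apply, Finset.sum_eq_single_of_mem k hk, Pi.single_eq_same,
      sub_self]
    exact fun i _ hi => Pi.single_eq_of_ne hi.symm _
  simp only [← pairLin_apply] at h1 ⊢
  rw [map_sub, map_sub, map_sum, map_sum] at h1
  exact sub_eq_zero.mp h1

theorem labelCondition_of_finset {m : ℕ} {Λ : Module.Dual ℂ (deg m 0)} {T : Finset ℤ}
    (hT : ∀ x : ℤ → TruncPoly m, (∀ k ∈ T, x k = 0) → Λ (pairEl x) = 0) : LabelCondition Λ := by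
  intro l _
  refine T.finite_toSet.subset fun k hk => ?_
  by_contra h
  exact hk ((apply_pairEl_single Λ l k).symm.trans
    (hT _ fun i hi => Pi.single_eq_of_ne (fun e : i = k => h (e ▸ hi)) _))

/-- For termwise `λ`, the label condition makes `λ` vanish on all sums `∑_k x_k H_k` supported away
from some finite interval. -/
theorem exists_interval_of_labelCondition {m : ℕ} {Λ : Module.Dual ℂ (deg m 0)}
    (ht : IsTermwise Λ) (hc : LabelCondition Λ) :
    ∃ M : ℕ, ∀ x : ℤ → TruncPoly m, (∀ k : ℤ, |k| ≤ M → x k = 0) → Λ (pairEl x) = 0 := by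
  have h1 : ∀ᶠ k : ℤ in Filter.cofinite, ∀ l ∈ Finset.range (m + 1),
      Λ (pairEl (Pi.single k (tVar m ^ l))) = 0 := by
    rw [Filter.eventually_all_finset]
    intro l hl
    filter_upwards [hc l (by simpa [Nat.lt_succ_iff] using hl)] with k hk
    rw [apply_pairEl_single, hk]
  have hfin := Filter.eventually_cofinite.mp h1
  refine ⟨hfin.toFinset.sup Int.natAbs, fun x hx => ?_⟩
  have h2 : ∀ k : ℤ, Λ (pairEl (Pi.single k (x k))) = 0 := by
    intro k
    by_cases hk : ∀ l ∈ Finset.range (m + 1), Λ (pairEl (Pi.single k (tVar m ^ l))) = 0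
    · exact apply_pairEl_single_eq_zero Λ (fun l hl => hk l (by simpa [Nat.lt_succ_iff] using hl)) _
    · rw [hx k, Pi.single_zero]
      · exact map_zero (Λ ∘ₗ pairLin m)
      · rw [Int.abs_eq_natAbs]
        exact_mod_cast Finset.le_sup (f := Int.natAbs) (hfin.mem_toFinset.mpr hk)
  -- Termwise evaluation is what carries the vanishing of each term over to the infinite sum.
  rw [ht x] <;> simp [h2]

/-! ### Vectors annihilated by elements supported far away. -/

namespace GradedModule

variable {m : ℕ} {V : Type*} [AddCommGroup V] [Module ℂ V]
  {Λ : Module.Dual ℂ (deg m 0)} {L : GradedModule m V} {v : V}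

/-- The elements of degree `-j` supported far from the origin annihilate `w`. -/
def KilledFar (L : GradedModule m V) (w : V) (j : ℤ) : Prop :=
  ∃ M : ℕ, ∀ y : ℤ → TruncPoly m, (∀ i : ℤ, |i| ≤ M → y i = 0) → L.act (shiftEl m (-j) y) w = 0

/-- Each element of degree `-(j+1)` supported far enough out is a combination of two brackets of far
elements of degrees -1 and `-j`, both of which kill `w`. -/
theorem KilledFar.succ {w : V} {j : ℕ} (h1 : L.KilledFar w 1) (hj : L.KilledFar w j) :
    L.KilledFar w (j + 1 : ℕ) := by
  obtain ⟨M₁, h1⟩ := h1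
  obtain ⟨M₂, h2⟩ := hj
  set M : ℕ := max M₁ M₂
  refine ⟨M + j + 1, fun y hy => ?_⟩
  have hy0 : ∀ i : ℤ, ¬ ((M : ℤ) + j + 1 < |i|) → y i = 0 := fun i hi => hy i (by push_cast; omega)
  have key : ∀ a b : ℤ → TruncPoly m, (∀ i : ℤ, |i| ≤ M → a i = 0) →
      (∀ i : ℤ, |i| ≤ M → b i = 0) →
      L.act (bracket (shiftEl m (-1) a) (shiftEl m (-j) b)) w = 0 := by
    intro a b ha hb
    have := L.act_act (shiftEl_mem (-1) a) (shiftEl_mem (-(j : ℤ)) b) w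
    rw [h1 a fun i hi => ha i (hi.trans (by exact_mod_cast le_max_left _ _)),
      h2 b fun i hi => hb i (hi.trans (by exact_mod_cast le_max_right _ _)),
      map_zero, map_zero, smul_zero, add_zero] at this
    exact this.symm
  let a₁ : ℤ → TruncPoly m := fun i => if |i| ≤ M then 0 else 1
  let a₂ : ℤ → TruncPoly m := fun i => if |i| ≤ M then 0 else (i : TruncPoly m)
  let b₁ : ℤ → TruncPoly m := fun i => -((i - j : ℤ) : TruncPoly m) * y (i + 1)
  let b₂ : ℤ → TruncPoly m := fun i => y (i + 1)
  have hb : ∀ i : ℤ, |i| ≤ M → y (i + 1) = 0 := fun i hi => hy0 _ (by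
    rw [abs_le] at hi
    rw [not_lt, abs_le]
    omega)
  have k1 := key a₁ b₁ (fun i hi => if_pos hi) fun i hi => by simp only [b₁, hb i hi, mul_zero]
  have k2 := key a₂ b₂ (fun i hi => if_pos hi) hb
  rw [bracket_shiftEl (by omega)] at k1 k2
  have hj1 : ((j : ℂ) + 1) ≠ 0 := by exact_mod_cast j.succ_ne_zero
  have e : y = ((j : ℂ) + 1)⁻¹ • ((fun i => a₁ i * b₁ (i + -1) -
      sgn (-1) (-j) • (b₁ i * a₁ (i + -j))) + fun i => a₂ i * b₂ (i + -1) -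
      sgn (-1) (-j) • (b₂ i * a₂ (i + -j))) := by
    rw [eq_inv_smul_iff₀ hj1]
    funext i
    have t1 : a₁ i * b₁ (i + -1) = -((i - 1 - j : ℤ) : TruncPoly m) * y i := by
      simp only [a₁, b₁, ← sub_eq_add_neg, sub_add_cancel]
      split_ifs with h
      · rw [hy0 i (by omega), mul_zero, mul_zero]
      · rw [one_mul]
    have t2 : a₂ i * b₂ (i + -1) = (i : TruncPoly m) * y i := by
      simp only [a₂, b₂, neg_add_cancel_right]
      split_ifs with h
      · rw [hy0 i (by omega), mul_zero, mul_zero]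
      · rfl
    have t3 : b₁ i * a₁ (i + -j) = -(b₂ i * a₂ (i + -j)) := by
      simp only [a₁, a₂, b₁, b₂, ← sub_eq_add_neg]
      split_ifs with h
      · simp
      · ring
    simp only [Pi.add_apply, Pi.smul_apply, t1, t2, t3, add_smul, one_smul, Nat.cast_smul_eq_nsmul,
      nsmul_eq_mul, smul_neg]
    push_cast
    ring
  rw [e, map_smul, map_add, map_smul, map_add, LinearMap.smul_apply, LinearMap.add_apply]
  rw [show (-((j + 1 : ℕ) : ℤ)) = -1 + -j by push_cast; ring, k1, k2, add_zero, smul_zero]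

/-- Commuting the two operators leaves a bracket of degree `-(j+p)`. Its coefficients involve `y` at
`i` and `i - p`, so enlarging the radius by `p` keeps it far out. -/
theorem KilledFar.act {w : V} (h : ∀ j : ℤ, 0 < j → L.KilledFar w j) {p : ℤ} (hp : 0 < p)
    (x : ℤ → TruncPoly m) {j : ℤ} (hj : 0 < j) :
    L.KilledFar (L.act (shiftEl m (-p) x) w) j := by
  obtain ⟨M₁, h1⟩ := h j hj
  obtain ⟨M₂, h2⟩ := h (j + p) (by omega)
  refine ⟨max M₁ M₂ + p.toNat, fun y hy => ?_⟩
  have hy0 : ∀ i : ℤ, |i| ≤ max (M₁ : ℤ) M₂ + p → y i = 0 := fun i hi => hy i (by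
    push_cast
    rwa [Int.toNat_of_nonneg hp.le])
  rw [L.act_act (shiftEl_mem _ _) (shiftEl_mem _ _), h1 y fun i hi => hy0 i (by omega), map_zero,
    smul_zero, add_zero, bracket_shiftEl (by omega), show -j + -p = -(j + p) by ring]
  refine h2 _ fun i hi => ?_
  rw [hy0 i (by omega), hy0 (i + -p) ?_, zero_mul, mul_zero, smul_zero, sub_zero]
  have := abs_add_le i (-p)
  rw [abs_neg, abs_of_pos hp] at this
  omega

/-- The vectors annihilated by all elements of a given negative degree supported far away. -/
def killedFarSubmodule (L : GradedModule m V) : Submodule ℂ V where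
  carrier := {w | ∀ j : ℤ, 0 < j → L.KilledFar w j}
  zero_mem' := fun j _ => ⟨0, fun y _ => map_zero _⟩
  add_mem' := fun {a b} ha hb j hj => by
    obtain ⟨M₁, h1⟩ := ha j hj
    obtain ⟨M₂, h2⟩ := hb j hj
    refine ⟨max M₁ M₂, fun y hy => ?_⟩
    rw [map_add, h1 y fun i hi => hy i (hi.trans (by exact_mod_cast le_max_left _ _)),
      h2 y fun i hi => hy i (hi.trans (by exact_mod_cast le_max_right _ _)), add_zero]
  smul_mem' := fun c a ha j hj => by
    obtain ⟨M, h⟩ := ha j hj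
    exact ⟨M, fun y hy => by rw [map_smul, h y hy, smul_zero]⟩

instance (m : ℕ) : Module.Finite ℂ (TruncPoly m) :=
  (Polynomial.monic_X_pow (m + 1)).finite_quotient

theorem KilledFar.finiteDimensional {w : V} {j : ℤ} (h : L.KilledFar w j) :
    FiniteDimensional ℂ (LinearMap.range (L.act.flip w ∘ₗ shiftEl m (-j))) := by
  obtain ⟨M, h⟩ := h
  let I := Finset.Icc (-(M : ℤ)) M
  -- Extension by zero from a finite window: the part of `y` outside it kills `w`, and `R_m` is
  -- finite-dimensional.
  let g : (I → TruncPoly m) →ₗ[ℂ] (ℤ → TruncPoly m) :=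
    LinearMap.pi fun i => if hi : i ∈ I then LinearMap.proj ⟨i, hi⟩ else 0
  refine Submodule.finiteDimensional_of_le
    (S₂ := LinearMap.range ((L.act.flip w ∘ₗ shiftEl m (-j)) ∘ₗ g)) ?_
  rintro _ ⟨y, rfl⟩
  refine ⟨fun i => y i, ?_⟩
  have := h (y - g fun i => y i) fun i hi => by
    have hi' : i ∈ I := Finset.mem_Icc.mpr (abs_le.mp hi)
    simp [g, hi']
  rw [map_sub, map_sub, LinearMap.sub_apply, sub_eq_zero] at this
  exact this.symm

/-! ### Finite-dimensionality of the homogeneous components. -/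

namespace IsHighestWeight

theorem killedFar_one (hL : L.IsHighestWeight Λ v) (hirr : L.IsIrreducible) {M : ℕ}
    (hM : ∀ x : ℤ → TruncPoly m, (∀ k : ℤ, |k| ≤ M → x k = 0) → Λ (pairEl x) = 0) :
    L.KilledFar v 1 := by
  refine ⟨M, fun y hy => hL.eq_zero_of_singular hirr (n := -1) (by norm_num)
    (L.mem_gr_add (shiftEl_mem _ _) hL.mem_gr_zero rfl) fun r hr x hx => ?_⟩
  by_cases h : r = 1
  · subst h
    obtain ⟨x, rfl⟩ := exists_shiftEl one_ne_zero hx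
    rw [hL.act_one_act_neg_one, hM _ fun k hk => by rw [hy k hk, mul_zero], zero_smul]
  -- In degree above ½ the bracket with degree -½ still has positive degree, so it kills `v`.
  · rw [L.act_act hx (shiftEl_mem _ _), hL.act_pos r hr x hx, map_zero, smul_zero, add_zero]
    exact hL.act_pos (r + -1) (by omega) _ (bracket_mem_deg hx (shiftEl_mem _ _))

theorem killedFar (hL : L.IsHighestWeight Λ v) (h1 : L.KilledFar v 1) (w : V) {j : ℤ}
    (hj : 0 < j) : L.KilledFar w j := by
  have hv : ∀ n : ℕ, L.KilledFar v (n + 1 : ℕ) := fun n => by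
    induction n with
    | zero => exact h1
    | succ n ih => exact h1.succ ih
  have : L.killedFarSubmodule = ⊤ := by
    refine hL.generated _ (fun j hj => ?_) fun r hr x hx w hw j hj => ?_
    · have := hv (j - 1).toNat
      rwa [show (((j - 1).toNat + 1 : ℕ) : ℤ) = j by omega] at this
    · obtain ⟨x, rfl⟩ := exists_shiftEl hr.ne hx
      rw [← neg_neg r]
      exact KilledFar.act hw (by omega) x hj
  exact (this ▸ Submodule.mem_top : w ∈ L.killedFarSubmodule) j hj

theorem finiteDimensional_gr_neg (hL : L.IsHighestWeight Λ v) (h1 : L.KilledFar v 1) (N : ℕ) :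
    FiniteDimensional ℂ (L.gr (-N)) := by
  induction N using Nat.strong_induction_on with
  | _ N ih =>
  rcases Nat.eq_zero_or_pos N with rfl | hN
  · rw [Nat.cast_zero, neg_zero, hL.gr_zero]
    infer_instance
  have hs : ∀ n : ℕ, ∃ s : Finset V, n < N → Submodule.span ℂ (s : Set V) = L.gr (-n) := fun n => by
    by_cases hn : n < N
    · obtain ⟨s, hs⟩ := Submodule.fg_iff_finiteDimensional _ |>.mpr (ih n hn)
      exact ⟨s, fun _ => hs⟩
    · exact ⟨∅, fun h => absurd h hn⟩
  choose s hs using hs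
  let R : ℕ → V → Submodule ℂ V := fun n w =>
    LinearMap.range (L.act.flip w ∘ₗ shiftEl m (-((N : ℤ) - n)))
  -- The part of degree `-N` reached from degrees `-n` with `n < N`; spanning sets of those
  -- components suffice by linearity.
  let X : Submodule ℂ V := ⨆ n ∈ Finset.range N, ⨆ w ∈ s n, R n w
  have hX : X.FG := Submodule.fg_biSup _ _ fun n hn => Submodule.fg_biSup _ _ fun w _ =>
    (Submodule.fg_iff_finiteDimensional _).mpr
      (hL.killedFar h1 w (by have := Finset.mem_range.mp hn; omega)).finiteDimensional
  have hXmem : ∀ n < N, ∀ x, ∀ w ∈ L.gr (-n), L.act (shiftEl m (-((N : ℤ) - n)) x) w ∈ X := by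
    intro n hn x
    suffices L.gr (-n) ≤ X.comap (L.act (shiftEl m (-((N : ℤ) - n)) x)) from this
    rw [← hs n hn, Submodule.span_le]
    exact fun w hw => Submodule.mem_iSup_of_mem n (Submodule.mem_iSup_of_mem
      (Finset.mem_range.mpr hn) (Submodule.mem_iSup_of_mem w (Submodule.mem_iSup_of_mem hw ⟨x, rfl⟩)))
  have hXle : X ≤ L.gr (-N) := by
    refine iSup₂_le fun n hn => iSup₂_le fun w hw => ?_
    rintro _ ⟨x, rfl⟩
    refine L.mem_gr_add (j := -n) (shiftEl_mem _ _) ?_ (by ring)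
    rw [← hs n (Finset.mem_range.mp hn)]
    exact Submodule.subset_span hw
  -- With `Y` the sum of all other components, `X ⊔ Y` contains `v` and is stable under negative
  -- degrees, so it is everything; the modular law then gives `L.gr (-N) = X`.
  let Y : Submodule ℂ V := ⨆ j ∈ ({-(N : ℤ)}ᶜ : Set ℤ), L.gr j
  have htop : X ⊔ Y = ⊤ := by
    have hY : ∀ i : ℤ, i ≠ -N → ∀ w ∈ L.gr i, w ∈ X ⊔ Y := fun i hi w hw =>
      Submodule.mem_sup_right (Submodule.mem_iSup_of_mem i (Submodule.mem_iSup_of_mem hi hw))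
    refine hL.generated _ (hY 0 (by omega) v hL.mem_gr_zero) fun r hr x hx w hw => ?_
    suffices X ⊔ Y ≤ (X ⊔ Y).comap (L.act x) from this hw
    refine sup_le (fun w hw => hY (r + -N) (by omega) _ (L.act_gr r _ x w hx (hXle hw)))
      (iSup₂_le fun i hi w hw => ?_)
    by_cases hri : r + i = -N
    · rcases lt_or_ge 0 i with h | h
      · rw [hL.gr_eq_bot h, Submodule.mem_bot] at hw
        rw [hw]
        exact Submodule.zero_mem _
      · obtain ⟨x, rfl⟩ := exists_shiftEl hr.ne hx
        obtain ⟨n, rfl⟩ := Int.exists_eq_neg_ofNat h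
        have := hXmem n (by omega) x w hw
        rw [show -((N : ℤ) - n) = r by omega] at this
        exact Submodule.mem_sup_left this
    · exact hY (r + i) hri _ (L.act_gr r i x w hx hw)
  have hdisj : Disjoint (L.gr (-N)) Y :=
    L.isInternal.submodule_iSupIndep.disjoint_biSup (by simp)
  have : L.gr (-N) = X := by
    have h := sup_inf_assoc_of_le Y hXle
    rwa [htop, top_inf_eq, inf_comm, hdisj.eq_bot, sup_bot_eq] at h
  rw [this]
  exact (Submodule.fg_iff_finiteDimensional _).mp hX

theorem isQuasifinite (hL : L.IsHighestWeight Λ v) (h1 : L.KilledFar v 1) : L.IsQuasifinite := by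
  intro j
  rcases lt_or_ge 0 j with h | h
  · rw [hL.gr_eq_bot h]
    infer_instance
  · obtain ⟨n, rfl⟩ := Int.exists_eq_neg_ofNat h
    exact hL.finiteDimensional_gr_neg h1 n

end IsHighestWeight
end GradedModule
end GlInf

theorem mainTheorem5 (m : ℕ) (Λ : Module.Dual ℂ (GlInf.deg m 0))
    {V : Type*} [AddCommGroup V] [Module ℂ V] (L : GlInf.GradedModule m V) (v : V)
    (hL : L.IsHighestWeight Λ v) (hirr : L.IsIrreducible) :
    (GlInf.IsTermwise Λ → (L.IsQuasifinite ↔ GlInf.LabelCondition Λ)) ∧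
      (L.IsQuasifinite → GlInf.IsTermwise Λ ∧ GlInf.LabelCondition Λ) := by
  have key : L.IsQuasifinite → GlInf.IsTermwise Λ ∧ GlInf.LabelCondition Λ := fun h => by
    obtain ⟨T, hT⟩ := hL.exists_finset_of_finiteDimensional (h (-1))
    exact ⟨GlInf.isTermwise_of_finset hT, GlInf.labelCondition_of_finset hT⟩
  refine ⟨fun ht => ⟨fun h => (key h).2, fun hc => ?_⟩, key⟩
  obtain ⟨M, hM⟩ := GlInf.exists_interval_of_labelCondition ht hc
  exact hL.isQuasifinite (hL.killedFar_one hirr hM)
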